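/- Let $m\in\mathbb{N}$, let $(\Omega,\mathcal F,\Pr)$ be a probability space and let $\{W(k)\}_{k\ge 0}$ be a random model, i.e. a sequence of random $m\times m$ (row-)stochastic matrices with Borel-measurable entries. Assume that: (i) the matrices $W(0),W(1),\dots$ are independent; (ii) there is a vector $\pi\in\mathbb{R}^m$ with all entries positive such that $\pi^T\,\mathbb{E}[W(k)]=\pi^T$ for all $k\ge0$ (common steady state $\pi>0$ in expectation); (iii) there is $\gamma>0$ such that $\mathbb{E}\big[W^i(k)^T W^j(k)\big]\ge\gamma\big(\mathbb{E}[W_{ij}(k)]+\mathbb{E}[W_{ji}(k)]\big)$ for all $k\ge 0$ and all $i\ne j$, where $W^i(k)$ is the $i$th column of $W(k)$ (weak feedback property). For a deterministic chain $\{A(k)\}$ of $m\times m$ stochastic matrices consider the dynamics $x(k+1)=A(k)x(k)$, $k\ge t_0$. An index $i$ is ergodic if $\lim_{k\to\infty}x_i(k)$ exists for every initial time $t_0\ge0$ and every initial point $x(t_0)\in\mathbb{R}^m$; the chain is stable if every index is ergodic; and $i,j$ are mutually ergodic if both are ergodic indices and $\lim_{k\to\infty}(x_i(k)-x_j(k))=0$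 for every $t_0\ge0$ and every $x(t_0)\in\mathbb{R}^m$. For the random model, write $i\Leftrightarrow j$ if almost surely $i$ and $j$ are mutually ergodic for the realized chain, and call the model stable if the realized chain is stable almost surely. The infinite flow graph $G^\infty$ of the model is the simple undirected graph on $\{1,\dots,m\}$ in which distinct $i,j$ are adjacent if and only if $\sum_{k=0}^\infty\big(W_{ij}(k)+W_{ji}(k)\big)=\infty$ almost surely. Then, for all $i,j\in\{1,\dots,m\}$, $i\Leftrightarrow j$ if and only if $i$ and $j$ lie in the same connected component of $G^\infty$. In particular, the model is stable. -/

import Mathlib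

open MeasureTheory ProbabilityTheory Filter Topology
open scoped Matrix

namespace RandomChain

variable {m : ℕ} {Ω : Type*} [MeasurableSpace Ω]

/-- `x` is a trajectory of the linear dynamics `x(k+1) = A(k) x(k)`, `k ≥ t₀`, with initial time
`t₀`; its initial point is `x t₀`. The values `x k` with `k < t₀` play no role. -/
def IsTrajectory (A : ℕ → Matrix (Fin m) (Fin m) ℝ) (t₀ : ℕ) (x : ℕ → Fin m → ℝ) : Prop :=
  ∀ k, t₀ ≤ k → x (k + 1) = A k *ᵥ x k

/-- `i ↔ j`: mutually weakly ergodic indices of a deterministic chain. -/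
def MutuallyWeaklyErgodic (A : ℕ → Matrix (Fin m) (Fin m) ℝ) (i j : Fin m) : Prop :=
  ∀ (t₀ : ℕ) (x : ℕ → Fin m → ℝ), IsTrajectory A t₀ x →
    Tendsto (fun k => x k i - x k j) atTop (𝓝 0)

/-- Ergodic index of a deterministic chain. -/
def ErgodicIndex (A : ℕ → Matrix (Fin m) (Fin m) ℝ) (i : Fin m) : Prop :=
  ∀ (t₀ : ℕ) (x : ℕ → Fin m → ℝ), IsTrajectory A t₀ x →
    ∃ l : ℝ, Tendsto (fun k => x k i) atTop (𝓝 l)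

/-- A deterministic chain is stable if every index is ergodic. -/
def IsStable (A : ℕ → Matrix (Fin m) (Fin m) ℝ) : Prop :=
  ∀ i, ErgodicIndex A i

/-- `i ⇔ j`: mutually ergodic indices of a deterministic chain. -/
def MutuallyErgodic (A : ℕ → Matrix (Fin m) (Fin m) ℝ) (i j : Fin m) : Prop :=
  ErgodicIndex A i ∧ ErgodicIndex A j ∧ MutuallyWeaklyErgodic A i j

/-- A random model: a sequence of random matrices with Borel measurable entries, all of whose
values are (row-)stochastic matrices. -/
structure IsRandomModel (W : ℕ → Ω → Matrix (Fin m) (Fin m) ℝ) : Prop where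
  measurable_entry : ∀ k i j, Measurable fun ω => W k ω i j
  stochastic : ∀ k ω, W k ω ∈ Matrix.rowStochastic ℝ (Fin m)

/-- The matrices `W(0), W(1), …` are (jointly) independent, each being regarded as a random
element of `ℝ^{m × m}` with the product (Borel) σ-algebra. -/
def IsIndependent (P : Measure Ω) (W : ℕ → Ω → Matrix (Fin m) (Fin m) ℝ) : Prop :=
  iIndepFun (fun (k : ℕ) (ω : Ω) => (fun i j => W k ω i j : Fin m → Fin m → ℝ)) P

/-- The entrywise expectation of the matrix `W(k)`. -/
noncomputable def expectedMatrix (P : Measure Ω) (W : ℕ → Ω → Matrix (Fin m) (Fin m) ℝ) (k : ℕ) :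
    Matrix (Fin m) (Fin m) ℝ :=
  Matrix.of fun i j => ∫ ω, W k ω i j ∂P

/-- `v` is a common steady state in expectation: `vᵀ E[W(k)] = vᵀ` for all `k`. -/
def HasCommonSteadyState (P : Measure Ω) (W : ℕ → Ω → Matrix (Fin m) (Fin m) ℝ)
    (v : Fin m → ℝ) : Prop :=
  ∀ k, v ᵥ* expectedMatrix P W k = v

/-- Weak feedback property; `(W k ω).col i` is the `i`-th column of the matrix `W k ω`. -/
def HasWeakFeedback (P : Measure Ω) (W : ℕ → Ω → Matrix (Fin m) (Fin m) ℝ) : Prop :=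
  ∃ γ : ℝ, 0 < γ ∧ ∀ (k : ℕ) (i j : Fin m), i ≠ j →
    γ * (expectedMatrix P W k i j + expectedMatrix P W k j i)
      ≤ ∫ ω, (W k ω).col i ⬝ᵥ (W k ω).col j ∂P

/-- The infinite flow graph of a random model: the simple graph on `Fin m` in which distinct
`i`, `j` are adjacent iff `∑ₖ (Wᵢⱼ(k) + Wⱼᵢ(k)) = ∞` almost surely. -/
def infiniteFlowGraph (P : Measure Ω) (W : ℕ → Ω → Matrix (Fin m) (Fin m) ℝ) :
    SimpleGraph (Fin m) where
  Adj i j := i ≠ j ∧ ∀ᵐ ω ∂P,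
    Tendsto (fun n => ∑ k ∈ Finset.range n, (W k ω i j + W k ω j i)) atTop atTop
  symm := ⟨fun i j h => ⟨h.1.symm, by simpa only [add_comm] using h.2⟩⟩
  loopless := ⟨fun _ h => h.1 rfl⟩

end RandomChain

-- Fix a deterministic starting vector in `[0,1]^m` and let `x(n)` be its random orbit. By
-- independence, `π` is a steady state on average even after conditioning on the past. Hence `∑ π_i
-- φ(x_i)` is a supermartingale for convex `φ`, and two choices of `φ` suffice.
--
-- For `φ(s) = s²`, the expected decrease is controlled through weak feedback: the sum of `(W_ij +
-- W_ji)(x_i - x_j)²` over time is almost surely finite (`ae_summable_flow_mul_sq`). In particular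
-- the increments of each coordinate vanish.
--
-- For `φ(s) = |s - c|`, the weighted sums converge almost surely for all rational `c` at once
-- (`ae_exists_tendsto_sum_abs`). If a coordinate with vanishing increments oscillated across an
-- interval, it would keep returning near each `c` there. The limit, as a function of `c`, would
-- then have a kink of fixed size at each of these points, which a Lipschitz function cannot have
-- (`exists_tendsto_of_step_of_sum_abs`). So every coordinate converges, which gives stability.
--
-- Across an edge of `G^∞` the flow is infinite while the weighted squared differences are summable,
-- so the limits agree, and they agree on components by transitivity. Conversely, Kolmogorov's
-- zero-one law makes the flow between non-adjacent indices finite. A component is then cut off by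
-- finite total flow, and its indicator, started late enough, stays separated
-- (`not_mutuallyWeaklyErgodic_of_summable`).

namespace RandomChain

/-! ### Convergence of slowly varying sequences -/

/-- A real sequence with vanishing increments which is infinitely often below and infinitely often
above a value `c` comes arbitrarily close to `c` infinitely often. -/
theorem frequently_abs_sub_lt_of_step {u : ℕ → ℝ}
    (hstep : Tendsto (fun n => u (n + 1) - u n) atTop (𝓝 0)) {c : ℝ}
    (hlow : ∃ᶠ n in atTop, u n ≤ c) (hhigh : ∃ᶠ n in atTop, c ≤ u n) {δ : ℝ} (hδ : 0 < δ) :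
    ∃ᶠ n in atTop, |u n - c| < δ := by
  by_contra hcon
  rw [not_frequently] at hcon
  have hev : ∀ᶠ n in atTop, |u (n + 1) - u n| < δ := by
    have := hstep.eventually (Metric.ball_mem_nhds 0 hδ)
    simpa [Real.dist_eq] using this
  obtain ⟨N, hN⟩ := eventually_atTop.1 (hcon.and hev)
  obtain ⟨n, hn, hnc⟩ := (frequently_atTop.1 hlow) N
  -- Steps shorter than `δ` cannot cross the avoided window `(c - δ, c + δ)`.
  have hbelow : ∀ k, n ≤ k → u k ≤ c - δ := by
    intro k hk
    induction k, hk using Nat.le_induction with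
    | base =>
      have := (hN n hn).1
      rw [not_lt, le_abs] at this
      rcases this with h | h <;> linarith
    | succ k hk ih =>
      have h1 := (hN (k + 1) (by omega)).1
      have h2 := abs_lt.1 (hN k (by omega)).2
      rw [not_lt, le_abs] at h1
      rcases h1 with h | h <;> linarith
  obtain ⟨k, hk, hkc⟩ := (frequently_atTop.1 hhigh) n
  linarith [hbelow k hk]

/-- Second differences of the function `c ↦ ∑ j, v j * |y j - c|` are bounded below near each
of its kinks. -/
theorem le_second_difference_sum_abs {ι : Type*} [Fintype ι] {v : ι → ℝ} (hv : ∀ i, 0 ≤ v i)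
    (y : ι → ℝ) (i : ι) (c h : ℝ) :
    2 * v i * (h - |y i - c|) ≤
      ∑ j, v j * |y j - (c + h)| + ∑ j, v j * |y j - (c - h)| - 2 * ∑ j, v j * |y j - c| := by
  -- Convexity makes every term nonnegative, so all but the term at `i` may be dropped.
  have hterm : ∀ j, 0 ≤ v j * (|y j - (c + h)| + |y j - (c - h)| - 2 * |y j - c|) := by
    intro j
    refine mul_nonneg (hv j) ?_
    have := abs_add_le (y j - (c + h)) (y j - (c - h))
    have h2 : |y j - (c + h) + (y j - (c - h))| = 2 * |y j - c| := by
      rw [show y j - (c + h) + (y j - (c - h)) = 2 * (y j - c) by ring, abs_mul, abs_two]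
    linarith
  have hsum : ∑ j, v j * |y j - (c + h)| + ∑ j, v j * |y j - (c - h)| - 2 * ∑ j, v j * |y j - c|
      = ∑ j, v j * (|y j - (c + h)| + |y j - (c - h)| - 2 * |y j - c|) := by
    rw [Finset.mul_sum, ← Finset.sum_add_distrib, ← Finset.sum_sub_distrib]
    exact Finset.sum_congr rfl fun j _ => by ring
  rw [hsum]
  refine le_trans ?_ (Finset.single_le_sum (fun j _ => hterm j) (Finset.mem_univ i))
  have h1 := abs_sub (y i - (c - h)) (y i - (c + h))
  have h2 : 2 * h ≤ |y i - (c - h) - (y i - (c + h))| :=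
    le_trans (le_of_eq (by ring)) (le_abs_self _)
  have : 2 * (h - |y i - c|) ≤ |y i - (c + h)| + |y i - (c - h)| - 2 * |y i - c| := by linarith
  nlinarith [mul_le_mul_of_nonneg_left this (hv i)]

/-- If the increments of a bounded sequence `x` in `ℝ^ι` tend to zero and, for every rational `c`,
the weighted sums `∑ j, v j * |x n j - c|` converge, then `x` converges coordinatewise. -/
theorem exists_tendsto_of_step_of_sum_abs {ι : Type*} [Fintype ι] {v : ι → ℝ} (hv : ∀ i, 0 < v i)
    {x : ℕ → ι → ℝ} (hx : ∀ n i, x n i ∈ Set.Icc (0 : ℝ) 1) {i : ι}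
    (hstep : Tendsto (fun n => x (n + 1) i - x n i) atTop (𝓝 0))
    (hconv : ∀ c : ℚ, ∃ l, Tendsto (fun n => ∑ j, v j * |x n j - c|) atTop (𝓝 l)) :
    ∃ l, Tendsto (fun n => x n i) atTop (𝓝 l) := by
  choose F hF using hconv
  set V := ∑ j, v j with hV
  have hlip : ∀ (c h : ℚ), 0 ≤ h → |F (c + h) - F c| ≤ V * h := by
    intro c h hh
    refine le_of_tendsto ((hF (c + h)).sub (hF c)).abs (Eventually.of_forall fun n => ?_)
    rw [← Finset.sum_sub_distrib, hV, Finset.sum_mul]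
    refine (Finset.abs_sum_le_sum_abs _ _).trans (Finset.sum_le_sum fun j _ => ?_)
    rw [← mul_sub, abs_mul, abs_of_pos (hv j)]
    refine mul_le_mul_of_nonneg_left ?_ (hv j).le
    refine (abs_abs_sub_abs_le _ _).trans (le_of_eq ?_)
    have : (0 : ℝ) ≤ h := by exact_mod_cast hh
    push_cast
    rw [show x n j - (c + h) - (x n j - c) = -(h : ℝ) by ring, abs_neg, abs_of_nonneg this]
  refine tendsto_of_no_upcrossings Rat.denseRange_cast ?_ ?_ ?_
  · rintro _ ⟨a, rfl⟩ _ ⟨b, rfl⟩ hab ⟨hlow, hhigh⟩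
    have hab' : a < b := by exact_mod_cast hab
    -- With `N` steps of length `h` from `a` to `b`, the first difference of `F` grows by at least
    -- `2 * N * v i * h`. By the Lipschitz bound it lies in `[-V h, V h]`, so `N > V / v i` is
    -- contradictory.
    obtain ⟨N, hN⟩ := exists_nat_gt (V / v i)
    have hVpos : 0 < V := Finset.sum_pos (fun j _ => hv j) ⟨i, Finset.mem_univ i⟩
    have hN0 : (0 : ℝ) < N := lt_trans (div_pos hVpos (hv i)) hN
    have hN0' : (0 : ℚ) < N := by exact_mod_cast hN0
    set h : ℚ := (b - a) / N with hh
    have hh0 : 0 < h := div_pos (sub_pos.2 hab') hN0'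
    have hh0' : (0 : ℝ) < h := by exact_mod_cast hh0
    have hNh : N * h = b - a := by rw [hh]; field_simp
    have hsecond : ∀ c : ℚ, a ≤ c → c ≤ b → 2 * v i * h ≤ F (c + h) + F (c - h) - 2 * F c := by
      intro c hac hcb
      have hac' : (a : ℝ) ≤ c := by exact_mod_cast hac
      have hcb' : (c : ℝ) ≤ b := by exact_mod_cast hcb
      have hlim := ((hF (c + h)).add (hF (c - h))).sub ((hF c).const_mul 2)
      refine le_of_forall_pos_le_add fun ε hε => ?_
      have hδ : 0 < ε / (2 * v i) := div_pos hε (by linarith [hv i])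
      have hfreq := frequently_abs_sub_lt_of_step hstep
        (hlow.mono fun n hn => hn.le.trans hac') (hhigh.mono fun n hn => hcb'.trans hn.le) hδ
      have hge : 2 * v i * h - ε ≤ F (c + h) + F (c - h) - 2 * F c := by
        refine ge_of_tendsto_of_frequently hlim (hfreq.mono fun n hn => ?_)
        have h2 := le_second_difference_sum_abs (fun j => (hv j).le) (x n) i c h
        rw [lt_div_iff₀ (by linarith [hv i])] at hn
        push_cast
        nlinarith
      linarith
    have hincr : ∀ n : ℕ, n ≤ N →
        F (a + h) - F a + 2 * n * v i * h ≤ F (a + n * h + h) - F (a + n * h) := by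
      intro n hn
      induction n with
      | zero => simp
      | succ n ih =>
        have h1 := ih (by omega)
        have hnN : ((n : ℚ) + 1) * h ≤ N * h :=
          mul_le_mul_of_nonneg_right (by exact_mod_cast hn) hh0.le
        have hn0 : 0 ≤ (n : ℚ) * h := mul_nonneg n.cast_nonneg hh0.le
        have h2 := hsecond (a + n * h + h) (by linarith) (by linarith)
        rw [add_sub_cancel_right] at h2
        rw [show a + ((n + 1 : ℕ) : ℚ) * h = a + n * h + h by push_cast; ring]
        push_cast
        linarith
    have h1 := hincr N le_rfl
    have h2 := abs_le.1 (hlip a h hh0.le)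
    have h3 := abs_le.1 (hlip (a + N * h) h hh0.le)
    rw [div_lt_iff₀ (hv i)] at hN
    nlinarith [mul_lt_mul_of_pos_right hN hh0']
  · exact isBoundedUnder_of ⟨1, fun n => (hx n i).2⟩
  · exact isBoundedUnder_of ⟨0, fun n => (hx n i).1⟩

/-! ### Stochastic matrices and deterministic chains -/

variable {m : ℕ}

/-- The states at times `1, 2, …` of the dynamics `x(k+1) = A(k) x(k)` started from `x₀` at
time `0`. -/
def orbit (A : ℕ → Matrix (Fin m) (Fin m) ℝ) (x₀ : Fin m → ℝ) : ℕ → Fin m → ℝ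
  | 0 => A 0 *ᵥ x₀
  | n + 1 => A (n + 1) *ᵥ orbit A x₀ n

theorem mulVec_mem_Icc {A : Matrix (Fin m) (Fin m) ℝ} (hA : A ∈ Matrix.rowStochastic ℝ (Fin m))
    {x : Fin m → ℝ} (hx : ∀ i, x i ∈ Set.Icc (0 : ℝ) 1) (i : Fin m) :
    (A *ᵥ x) i ∈ Set.Icc (0 : ℝ) 1 := by
  obtain ⟨hA0, hA1⟩ := Matrix.mem_rowStochastic_iff_sum.1 hA
  simp only [Matrix.mulVec, dotProduct]
  refine ⟨Finset.sum_nonneg fun j _ => mul_nonneg (hA0 i j) (hx j).1, ?_⟩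
  rw [← hA1 i]
  exact Finset.sum_le_sum fun j _ => mul_le_of_le_one_right (hA0 i j) (hx j).2

theorem orbit_mem_Icc {A : ℕ → Matrix (Fin m) (Fin m) ℝ}
    (hA : ∀ k, A k ∈ Matrix.rowStochastic ℝ (Fin m)) {x₀ : Fin m → ℝ}
    (hx₀ : ∀ i, x₀ i ∈ Set.Icc (0 : ℝ) 1) (n : ℕ) (i : Fin m) :
    orbit A x₀ n i ∈ Set.Icc (0 : ℝ) 1 := by
  induction n generalizing i with
  | zero => exact mulVec_mem_Icc (hA 0) hx₀ i
  | succ n ih => exact mulVec_mem_Icc (hA (n + 1)) ih i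

/-- Trajectories are linear combinations of orbits of the standard basis vectors. -/
theorem IsTrajectory.eq_sum_orbit {A : ℕ → Matrix (Fin m) (Fin m) ℝ} {t₀ : ℕ} {x : ℕ → Fin m → ℝ}
    (hx : IsTrajectory A t₀ x) (n : ℕ) :
    x (n + (t₀ + 1)) = ∑ l, x t₀ l • orbit (fun k => A (t₀ + k)) (Pi.single l 1) n := by
  induction n with
  | zero =>
    rw [zero_add, hx t₀ le_rfl]
    conv_lhs => rw [pi_eq_sum_univ' (x t₀)]
    rw [Matrix.mulVec_sum]
    refine Finset.sum_congr rfl fun l _ => ?_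
    rw [Matrix.mulVec_smul, orbit, add_zero]
  | succ n ih =>
    rw [show n + 1 + (t₀ + 1) = n + (t₀ + 1) + 1 by omega, hx _ (by omega), ih, Matrix.mulVec_sum]
    refine Finset.sum_congr rfl fun l _ => ?_
    rw [Matrix.mulVec_smul, orbit, show t₀ + (n + 1) = n + (t₀ + 1) by omega]

theorem exists_isTrajectory (A : ℕ → Matrix (Fin m) (Fin m) ℝ) (t₀ : ℕ) (x₀ : Fin m → ℝ) :
    ∃ x, IsTrajectory A t₀ x ∧ x t₀ = x₀ := by
  refine ⟨fun k => Nat.rec x₀ (fun n y => A (t₀ + n) *ᵥ y) (k - t₀), fun k hk => ?_, ?_⟩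
  · obtain ⟨n, rfl⟩ := Nat.exists_eq_add_of_le hk
    have h1 : t₀ + n + 1 - t₀ = n + 1 := by omega
    have h2 : t₀ + n - t₀ = n := by omega
    simp only [h1, h2]
  · simp

/-- By linearity, the uncountably many initial points reduce to countably many pairs `(t₀, l)`, so
that almost sure statements can be combined. -/
theorem ErgodicIndex.of_orbit {A : ℕ → Matrix (Fin m) (Fin m) ℝ} {i : Fin m}
    (h : ∀ t₀ l, ∃ a, Tendsto (fun n => orbit (fun k => A (t₀ + k)) (Pi.single l 1) n i)
      atTop (𝓝 a)) : ErgodicIndex A i := by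
  intro t₀ x hx
  choose a ha using h t₀
  refine ⟨∑ l, x t₀ l * a l, (tendsto_add_atTop_iff_nat (t₀ + 1)).1 ?_⟩
  simp only [hx.eq_sum_orbit, Finset.sum_apply, Pi.smul_apply, smul_eq_mul]
  exact tendsto_finsetSum _ fun l _ => (ha l).const_mul _

theorem MutuallyWeaklyErgodic.of_orbit {A : ℕ → Matrix (Fin m) (Fin m) ℝ} {i j : Fin m}
    (h : ∀ t₀ l, Tendsto (fun n => orbit (fun k => A (t₀ + k)) (Pi.single l 1) n i -
      orbit (fun k => A (t₀ + k)) (Pi.single l 1) n j) atTop (𝓝 0)) :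
    MutuallyWeaklyErgodic A i j := by
  intro t₀ x hx
  refine (tendsto_add_atTop_iff_nat (t₀ + 1)).1 ?_
  have := tendsto_finsetSum Finset.univ fun l _ => (h t₀ l).const_mul (x t₀ l)
  simpa only [hx.eq_sum_orbit, Finset.sum_apply, Pi.smul_apply, smul_eq_mul, mul_zero,
    Finset.sum_const_zero, mul_sub, Finset.sum_sub_distrib] using this

theorem MutuallyWeaklyErgodic.trans {A : ℕ → Matrix (Fin m) (Fin m) ℝ} {i j k : Fin m}
    (hij : MutuallyWeaklyErgodic A i j) (hjk : MutuallyWeaklyErgodic A j k) :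
    MutuallyWeaklyErgodic A i k := fun t₀ x hx => by
  simpa using (hij t₀ x hx).add (hjk t₀ x hx)

/-- If the total flow of a chain across the cut `(S, Sᶜ)` is finite, then no index in `S` is
mutually weakly ergodic with an index outside `S`. -/
theorem not_mutuallyWeaklyErgodic_of_summable {A : ℕ → Matrix (Fin m) (Fin m) ℝ}
    (hA : ∀ k, A k ∈ Matrix.rowStochastic ℝ (Fin m)) {S : Set (Fin m)}
    (hS : ∀ p ∈ S, ∀ q ∉ S, Summable fun k => A k p q + A k q p)
    {i j : Fin m} (hi : i ∈ S) (hj : j ∉ S) : ¬ MutuallyWeaklyErgodic A i j := by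
  classical
  intro herg
  have hA0 : ∀ k p q, 0 ≤ A k p q := fun k => (Matrix.mem_rowStochastic_iff_sum.1 (hA k)).1
  have hA1 : ∀ k p, ∑ q, A k p q = 1 := fun k => (Matrix.mem_rowStochastic_iff_sum.1 (hA k)).2
  -- `c` keeps only the entries crossing the cut; `ε k` below is the total crossing flow at time
  -- `k`.
  set c : ℕ → Fin m → Fin m → ℝ := fun k p q => if (p ∈ S ↔ q ∈ S) then 0 else A k p q with hc
  have hc0 : ∀ k p q, 0 ≤ c k p q := fun k p q => by
    simp only [hc]; split_ifs; exacts [le_rfl, hA0 k p q]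
  have hcsum : ∀ p q, Summable fun k => c k p q := by
    intro p q
    by_cases hp : p ∈ S <;> by_cases hq : q ∈ S <;> simp only [hc, hp, hq, iff_self, if_true,
      iff_false, iff_true, not_true, if_false, summable_zero]
    · exact (hS p hp q hq).of_nonneg_of_le (fun k => hA0 k p q)
        fun k => le_add_of_nonneg_right (hA0 k q p)
    · exact (hS q hq p hp).of_nonneg_of_le (fun k => hA0 k p q)
        fun k => le_add_of_nonneg_left (hA0 k q p)
  set ε : ℕ → ℝ := fun k => ∑ p, ∑ q, c k p q with hε
  have hε0 : ∀ k, 0 ≤ ε k := fun k =>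
    Finset.sum_nonneg fun p _ => Finset.sum_nonneg fun q _ => hc0 k p q
  have hεsum : Summable ε := summable_sum fun p _ => summable_sum fun q _ => hcsum p q
  have hrow : ∀ k p, ∑ q, c k p q ≤ ε k := fun k p =>
    Finset.single_le_sum (f := fun p => ∑ q, c k p q)
      (fun p _ => Finset.sum_nonneg fun q _ => hc0 k p q) (Finset.mem_univ p)
  -- Starting from the indicator of `S` at this time, no coordinate moves by more than `1/4`, so `x
  -- i - x j ≥ 1/2` forever.
  obtain ⟨t₀, ht₀⟩ : ∃ t₀, ∑' k, ε (k + t₀) < 1 / 4 :=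
    ((tendsto_sum_nat_add ε).eventually (gt_mem_nhds (by norm_num))).exists
  obtain ⟨x, hx, hx₀⟩ := exists_isTrajectory A t₀ (S.indicator 1)
  have hmem : ∀ n p, x (t₀ + n) p ∈ Set.Icc (0 : ℝ) 1 := by
    intro n
    induction n with
    | zero =>
      intro p
      rw [add_zero, hx₀]
      by_cases hp : p ∈ S <;> simp [hp]
    | succ n ih =>
      rw [← add_assoc, hx _ (by omega)]
      exact mulVec_mem_Icc (hA _) ih
  have hdev : ∀ n p, |x (t₀ + n) p - S.indicator 1 p| ≤ ∑ k ∈ Finset.range n, ε (k + t₀) := by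
    intro n
    induction n with
    | zero => intro p; simp [hx₀]
    | succ n ih =>
      intro p
      set σ := ∑ k ∈ Finset.range n, ε (k + t₀) with hσ
      have hσ0 : 0 ≤ σ := Finset.sum_nonneg fun k _ => hε0 _
      have heq : x (t₀ + (n + 1)) p - S.indicator 1 p =
          ∑ q, A (t₀ + n) p q * (x (t₀ + n) q - S.indicator 1 p) := by
        rw [← add_assoc, hx _ (by omega)]
        simp only [mul_sub, Finset.sum_sub_distrib, ← Finset.sum_mul, hA1, one_mul]
        rfl
      rw [heq, Finset.sum_range_succ]
      calc |∑ q, A (t₀ + n) p q * (x (t₀ + n) q - S.indicator 1 p)|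
          ≤ ∑ q, (A (t₀ + n) p q * σ + c (t₀ + n) p q) := by
            refine (Finset.abs_sum_le_sum_abs _ _).trans (Finset.sum_le_sum fun q _ => ?_)
            rw [abs_mul, abs_of_nonneg (hA0 _ p q)]
            -- On the same side of the cut the earlier deviation bound applies; across it the
            -- trivial bound `1` is charged to the crossing flow.
            by_cases hpq : p ∈ S ↔ q ∈ S
            · have hind : S.indicator (1 : Fin m → ℝ) p = S.indicator 1 q := by
                simp only [Set.indicator_apply, hpq, Pi.one_apply]
              rw [hind]
              exact le_add_of_le_of_nonneg
                (mul_le_mul_of_nonneg_left (ih q) (hA0 _ p q)) (hc0 _ p q)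
            · have hle : |x (t₀ + n) q - S.indicator 1 p| ≤ 1 := by
                have h1 := hmem n q
                rw [abs_le]
                by_cases hp : p ∈ S <;> simp only [hp, Set.indicator_of_mem,
                  Set.indicator_of_notMem, not_false_eq_true, Pi.one_apply] <;>
                  constructor <;> linarith [h1.1, h1.2]
              have hceq : c (t₀ + n) p q = A (t₀ + n) p q := if_neg hpq
              rw [hceq]
              exact le_add_of_nonneg_of_le (mul_nonneg (hA0 _ p q) hσ0)
                (mul_le_of_le_one_right (hA0 _ p q) hle)
        _ ≤ σ + ε (n + t₀) := by
            rw [Finset.sum_add_distrib, ← Finset.sum_mul, hA1, one_mul, add_comm n t₀]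
            gcongr
            exact hrow _ p
  have hdev' : ∀ n p, |x (t₀ + n) p - S.indicator 1 p| ≤ 1 / 4 := fun n p =>
    (hdev n p).trans (((summable_nat_add_iff t₀).2 hεsum).sum_le_tsum _
      (fun k _ => hε0 _) |>.trans ht₀.le)
  have hlim := (tendsto_add_atTop_iff_nat t₀).2 (herg t₀ x hx)
  have : (1 / 2 : ℝ) ≤ 0 := by
    refine ge_of_tendsto hlim (Eventually.of_forall fun n => ?_)
    have h1 := abs_le.1 (hdev' n i)
    have h2 := abs_le.1 (hdev' n j)
    simp only [hi, hj, Set.indicator_of_mem, Set.indicator_of_notMem, not_false_eq_true,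
      Pi.one_apply] at h1 h2
    rw [add_comm n t₀]
    linarith [h1.1, h2.2]
  norm_num at this

end RandomChain

namespace RandomChain

/-! ### Independence along the natural filtration -/

variable {m : ℕ} {Ω : Type*} [MeasurableSpace Ω]

variable {P : Measure Ω} {W : ℕ → Ω → Matrix (Fin m) (Fin m) ℝ}

theorem IsRandomModel.measurable_entries (hW : IsRandomModel W) (k : ℕ) :
    Measurable fun ω => (fun i j => W k ω i j : Fin m → Fin m → ℝ) :=
  measurable_pi_iff.2 fun i => measurable_pi_iff.2 fun j => hW.measurable_entry k i j

theorem IsRandomModel.nonneg (hW : IsRandomModel W) (k : ℕ) (ω : Ω) (i j : Fin m) :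
    0 ≤ W k ω i j :=
  Matrix.nonneg_of_mem_rowStochastic (hW.stochastic k ω)

theorem IsRandomModel.sum_row (hW : IsRandomModel W) (k : ℕ) (ω : Ω) (i : Fin m) :
    ∑ j, W k ω i j = 1 :=
  Matrix.sum_row_of_mem_rowStochastic (hW.stochastic k ω) i

theorem IsRandomModel.norm_entry_le (hW : IsRandomModel W) (k : ℕ) (ω : Ω) (i j : Fin m) :
    ‖W k ω i j‖ ≤ 1 := by
  rw [Real.norm_of_nonneg (hW.nonneg k ω i j)]
  exact Matrix.le_one_of_mem_rowStochastic (hW.stochastic k ω)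

/-- The filtration generated by the matrices `W(0), W(1), …`. -/
noncomputable def IsRandomModel.filtration (hW : IsRandomModel W) :
    Filtration ℕ (inferInstance : MeasurableSpace Ω) :=
  Filtration.natural (fun k ω => (fun i j => W k ω i j : Fin m → Fin m → ℝ))
    fun k => (hW.measurable_entries k).stronglyMeasurable

theorem IsRandomModel.measurable_entry_filtration (hW : IsRandomModel W) {k n : ℕ} (hkn : k ≤ n)
    (i j : Fin m) : Measurable[hW.filtration n] fun ω => W k ω i j := by
  have h1 : Measurable[hW.filtration n]
      fun ω => (fun i j => W k ω i j : Fin m → Fin m → ℝ) :=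
    (Filtration.stronglyAdapted_natural
      (fun k => (hW.measurable_entries k).stronglyMeasurable) k).measurable.mono
      (hW.filtration.mono hkn) le_rfl
  exact (measurable_pi_apply j).comp ((measurable_pi_apply i).comp h1)

/-- Since `orbit` begins with `A 0 *ᵥ x₀`, its term `n` involves exactly `W(0), …, W(n)` and is thus
independent of `W(n+1)`. -/
theorem IsRandomModel.measurable_orbit (hW : IsRandomModel W) (x₀ : Fin m → ℝ) (n : ℕ)
    (i : Fin m) : Measurable[hW.filtration n] fun ω => orbit (fun k => W k ω) x₀ n i := by
  induction n generalizing i with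
  | zero =>
    simp only [orbit, Matrix.mulVec, dotProduct]
    exact Finset.measurable_fun_sum _ fun j _ =>
      (hW.measurable_entry_filtration le_rfl i j).mul_const _
  | succ n ih =>
    simp only [orbit, Matrix.mulVec, dotProduct]
    exact Finset.measurable_fun_sum _ fun j _ => (hW.measurable_entry_filtration le_rfl i j).mul
      ((ih j).mono (hW.filtration.mono n.le_succ) le_rfl)

/-- A function of `W(n+1)` is uncorrelated with every function of `W(0), …, W(n)`. -/
theorem integral_mul_of_measurable_filtration (hW : IsRandomModel W) (hindep : IsIndependent P W)
    {g : (Fin m → Fin m → ℝ) → ℝ} (hg : Measurable g) {n : ℕ} {f : Ω → ℝ}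
    (hf : Measurable[hW.filtration n] f) :
    ∫ ω, g (fun i j => W (n + 1) ω i j) * f ω ∂P =
      (∫ ω, g (fun i j => W (n + 1) ω i j) ∂P) * ∫ ω, f ω ∂P := by
  have hind := hindep.indep_comap_natural_of_lt
    (fun k => (hW.measurable_entries k).stronglyMeasurable) n.lt_succ_self
  have hfun : IndepFun (fun ω => g (fun i j => W (n + 1) ω i j)) f P := by
    refine indep_of_indep_of_le_left (indep_of_indep_of_le_right hind hf.comap_le) ?_
    exact (hg.comp (comap_measurable _)).comap_le
  exact hfun.integral_fun_mul_eq_mul_integral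
    (hg.comp (hW.measurable_entries (n + 1))).aestronglyMeasurable
    (hf.mono (hW.filtration.le n) le_rfl).aestronglyMeasurable

theorem integrable_entry_mul (hW : IsRandomModel W) (k : ℕ) (i j : Fin m) {f : Ω → ℝ}
    (hf : Integrable f P) : Integrable (fun ω => W k ω i j * f ω) P :=
  hf.bdd_mul (hW.measurable_entry k i j).aestronglyMeasurable
    (ae_of_all _ fun ω => hW.norm_entry_le k ω i j)

theorem integral_entry_mul (hW : IsRandomModel W) (hindep : IsIndependent P W) {n : ℕ}
    (i j : Fin m) {f : Ω → ℝ} (hf : Measurable[hW.filtration n] f) :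
    ∫ ω, W (n + 1) ω i j * f ω ∂P = expectedMatrix P W (n + 1) i j * ∫ ω, f ω ∂P :=
  integral_mul_of_measurable_filtration hW hindep (g := fun M => M i j) (by fun_prop) hf

/-- A steady state in expectation is preserved by averaging against functions of the past. -/
theorem integral_sum_steady (hW : IsRandomModel W) (hindep : IsIndependent P W) {v : Fin m → ℝ}
    (hsteady : HasCommonSteadyState P W v) {n : ℕ} {f : Fin m → Ω → ℝ}
    (hf : ∀ i, Measurable[hW.filtration n] (f i)) (hfi : ∀ i, Integrable (f i) P) :
    ∫ ω, ∑ l, v l * ∑ i, W (n + 1) ω l i * f i ω ∂P = ∫ ω, ∑ i, v i * f i ω ∂P := by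
  have hint : ∀ l i, Integrable (fun ω => W (n + 1) ω l i * f i ω) P := fun l i =>
    integrable_entry_mul hW _ _ _ (hfi i)
  rw [integral_finsetSum _ fun l _ => (integrable_finsetSum _ fun i _ => hint l i).const_mul _,
    integral_finsetSum _ fun i _ => (hfi i).const_mul _]
  simp only [integral_const_mul]
  have h1 : ∀ l, ∫ ω, ∑ i, W (n + 1) ω l i * f i ω ∂P =
      ∑ i, expectedMatrix P W (n + 1) l i * ∫ ω, f i ω ∂P := by
    intro l
    rw [integral_finsetSum _ fun i _ => hint l i]
    exact Finset.sum_congr rfl fun i _ => integral_entry_mul hW hindep l i (hf i)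
  simp only [h1, Finset.mul_sum]
  rw [Finset.sum_comm]
  refine Finset.sum_congr rfl fun i _ => ?_
  have h2 : ∑ l, v l * expectedMatrix P W (n + 1) l i = v i := congrFun (hsteady (n + 1)) i
  simp only [← mul_assoc, ← Finset.sum_mul, h2]

/-! ### Convex comparison functions along random orbits -/

theorem IsRandomModel.orbit_mem_Icc (hW : IsRandomModel W) {x₀ : Fin m → ℝ}
    (hx₀ : ∀ i, x₀ i ∈ Set.Icc (0 : ℝ) 1) (n : ℕ) (ω : Ω) (i : Fin m) :
    orbit (fun k => W k ω) x₀ n i ∈ Set.Icc (0 : ℝ) 1 :=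
  RandomChain.orbit_mem_Icc (fun k => hW.stochastic k ω) hx₀ n i

theorem abs_orbit_sub_le (hW : IsRandomModel W) {x₀ : Fin m → ℝ}
    (hx₀ : ∀ i, x₀ i ∈ Set.Icc (0 : ℝ) 1) (c : ℝ) (n : ℕ) (ω : Ω) (i : Fin m) :
    |orbit (fun k => W k ω) x₀ n i - c| ≤ 1 + |c| := by
  refine (abs_sub _ _).trans (add_le_add_left ?_ _)
  rw [abs_of_nonneg (hW.orbit_mem_Icc hx₀ n ω i).1]
  exact (hW.orbit_mem_Icc hx₀ n ω i).2

/-- Each row of `W(n+1)` averages, so the triangle inequality and the steady state make the sum a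
bounded supermartingale, and martingale convergence applies to its negative. -/
theorem ae_exists_tendsto_sum_abs [IsProbabilityMeasure P] (hW : IsRandomModel W)
    (hindep : IsIndependent P W) {v : Fin m → ℝ} (hv : ∀ i, 0 < v i)
    (hsteady : HasCommonSteadyState P W v) {x₀ : Fin m → ℝ}
    (hx₀ : ∀ i, x₀ i ∈ Set.Icc (0 : ℝ) 1) (c : ℝ) :
    ∀ᵐ ω ∂P, ∃ l, Tendsto (fun n => ∑ i, v i * |orbit (fun k => W k ω) x₀ n i - c|)
      atTop (𝓝 l) := by
  have hmeas : ∀ n i, Measurable[hW.filtration n]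
      fun ω => |orbit (fun k => W k ω) x₀ n i - c| := fun n i =>
    measurable_norm.comp ((hW.measurable_orbit x₀ n i).sub_const c)
  have hint : ∀ n i, Integrable (fun ω => |orbit (fun k => W k ω) x₀ n i - c|) P := fun n i =>
    .of_bound ((hmeas n i).mono (hW.filtration.le n) le_rfl).aestronglyMeasurable (1 + |c|)
      (ae_of_all _ fun ω => by
        rw [Real.norm_eq_abs, abs_abs]; exact abs_orbit_sub_le hW hx₀ c n ω i)
  set M : ℕ → Ω → ℝ := fun n ω => ∑ i, v i * |orbit (fun k => W k ω) x₀ n i - c| with hM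
  have hMmeas : ∀ n, Measurable[hW.filtration n] (M n) := fun n =>
    Finset.measurable_fun_sum _ fun i _ => (hmeas n i).const_mul _
  have hMint : ∀ n, Integrable (M n) P := fun n =>
    integrable_finsetSum _ fun i _ => (hint n i).const_mul _
  have hsuper : Supermartingale M hW.filtration P := by
    refine supermartingale_of_setIntegral_succ_le
      (fun n => (hMmeas n).stronglyMeasurable) hMint fun n s hs => ?_
    have hs' : MeasurableSet s := hW.filtration.le n s hs
    -- The indicator of the past event `s` is absorbed into the test functions, so
    -- `integral_sum_steady` replaces a computation of conditional expectations.
    set f : Fin m → Ω → ℝ := fun i => s.indicator fun ω => |orbit (fun k => W k ω) x₀ n i - c|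
      with hf
    have hfi : ∀ i, Integrable (f i) P := fun i => (hint n i).indicator hs'
    have key := integral_sum_steady hW hindep hsteady (n := n) (f := f)
      (fun i => (hmeas n i).indicator hs) hfi
    rw [← integral_indicator hs', ← integral_indicator hs']
    have hright : s.indicator (M n) = fun ω => ∑ i, v i * f i ω := by
      ext ω
      by_cases hω : ω ∈ s <;> simp [hf, hM, hω]
    rw [hright, ← key]
    refine integral_mono ((hMint (n + 1)).indicator hs') (integrable_finsetSum _ fun l _ =>
      (integrable_finsetSum _ fun i _ => integrable_entry_mul hW _ _ _ (hfi i)).const_mul _)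
      fun ω => ?_
    by_cases hω : ω ∈ s
    · simp only [hf, hM, hω, Set.indicator_of_mem]
      refine Finset.sum_le_sum fun l _ => mul_le_mul_of_nonneg_left ?_ (hv l).le
      have heq : orbit (fun k => W k ω) x₀ (n + 1) l - c =
          ∑ i, W (n + 1) ω l i * (orbit (fun k => W k ω) x₀ n i - c) := by
        simp only [mul_sub, Finset.sum_sub_distrib, ← Finset.sum_mul, hW.sum_row, one_mul]
        rfl
      rw [heq]
      refine (Finset.abs_sum_le_sum_abs _ _).trans (Finset.sum_le_sum fun i _ => ?_)
      rw [abs_mul, abs_of_nonneg (hW.nonneg _ _ _ _)]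
    · simp [hf, hω]
  have hbound : ∀ n, eLpNorm ((-M) n) 1 P ≤ ((∑ i, v i) * (1 + |c|)).toNNReal := by
    intro n
    refine (eLpNorm_le_of_ae_bound (C := (∑ i, v i) * (1 + |c|)) (ae_of_all _ fun ω => ?_)).trans ?_
    · rw [Pi.neg_apply, Pi.neg_apply, norm_neg, Real.norm_of_nonneg
        (Finset.sum_nonneg fun i _ => mul_nonneg (hv i).le (abs_nonneg _)), Finset.sum_mul]
      exact Finset.sum_le_sum fun i _ =>
        mul_le_mul_of_nonneg_left (abs_orbit_sub_le hW hx₀ c n ω i) (hv i).le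
    · simp [ENNReal.ofReal]
  filter_upwards [hsuper.neg.exists_ae_tendsto_of_bdd hbound] with ω ⟨l, hl⟩
  exact ⟨-l, by simpa using hl.neg⟩

/-- Jensen's inequality for the square with its exact defect, the variance written over pairs; the
products `w i * w j` are what weak feedback bounds after summing over rows. -/
theorem sq_sum_weighted {ι : Type*} [Fintype ι] {w : ι → ℝ} (hw : ∑ i, w i = 1) (x : ι → ℝ) :
    (∑ i, w i * x i) ^ 2 =
      ∑ i, w i * x i ^ 2 - 1 / 2 * ∑ i, ∑ j, w i * w j * (x i - x j) ^ 2 := by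
  have h1 : ∑ i, ∑ j, w i * w j * (x i - x j) ^ 2 =
      ∑ i, ∑ j, (w i * x i ^ 2 * w j) + ∑ i, ∑ j, (w i * (w j * x j ^ 2))
        - 2 * ∑ i, ∑ j, (w i * x i) * (w j * x j) := by
    simp only [Finset.mul_sum, ← Finset.sum_add_distrib, ← Finset.sum_sub_distrib]
    exact Finset.sum_congr rfl fun i _ => Finset.sum_congr rfl fun j _ => by ring
  rw [h1, sq]
  simp only [← Finset.mul_sum, ← Finset.sum_mul, hw]
  ring

theorem ae_summable_of_sum_integral_le {f : ℕ → Ω → ℝ} (hf : ∀ n, Integrable (f n) P)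
    (hf0 : ∀ n ω, 0 ≤ f n ω) {C : ℝ} (hC : ∀ N, ∑ n ∈ Finset.range N, ∫ ω, f n ω ∂P ≤ C) :
    ∀ᵐ ω ∂P, Summable fun n => f n ω := by
  have hsum : Summable fun n => ∫ ω, f n ω ∂P :=
    summable_of_sum_range_le (fun n => integral_nonneg (hf0 n)) hC
  have h := summable_norm_of_tsum_eLpNorm_ne_top (μ := P) le_rfl
    (fun n => (hf n).aestronglyMeasurable) (by
      have : ∀ n, eLpNorm (f n) 1 P = ENNReal.ofReal (∫ ω, f n ω ∂P) := fun n => by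
        rw [eLpNorm_one_eq_lintegral_enorm,
          ofReal_integral_eq_lintegral_ofReal (hf n) (ae_of_all _ (hf0 n))]
        exact lintegral_congr fun ω => Real.enorm_of_nonneg (hf0 n ω)
      simp only [this]
      rw [← ENNReal.ofReal_tsum_of_nonneg (fun n => integral_nonneg (hf0 n)) hsum]
      exact ENNReal.ofReal_ne_top)
  filter_upwards [h] with ω hω using hω.of_norm

/-- The energy `Q n = ∑ v i * x_i ^ 2` is nonnegative and its expectation drops at each step by at
least a fixed multiple of the expected flow-weighted squared differences. Telescoping bounds the sum
of those expectations. -/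
theorem ae_summable_flow_mul_sq [IsProbabilityMeasure P] (hW : IsRandomModel W)
    (hindep : IsIndependent P W) {v : Fin m → ℝ} (hv : ∀ i, 0 < v i)
    (hsteady : HasCommonSteadyState P W v) (hfeedback : HasWeakFeedback P W) {x₀ : Fin m → ℝ}
    (hx₀ : ∀ i, x₀ i ∈ Set.Icc (0 : ℝ) 1) :
    ∀ᵐ ω ∂P, ∀ i j, Summable fun n => (W (n + 1) ω i j + W (n + 1) ω j i) *
      (orbit (fun k => W k ω) x₀ n i - orbit (fun k => W k ω) x₀ n j) ^ 2 := by
  obtain ⟨γ, hγ, hfb⟩ := hfeedback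
  obtain ⟨δ, hδ, hδv⟩ : ∃ δ : ℝ, 0 < δ ∧ ∀ l, δ ≤ v l := by
    rcases isEmpty_or_nonempty (Fin m) with h | h
    · exact ⟨1, one_pos, fun l => isEmptyElim l⟩
    · obtain ⟨l, hl⟩ := Finite.exists_min v
      exact ⟨v l, hv l, hl⟩
  set X : ℕ → Ω → Fin m → ℝ := fun n ω => orbit (fun k => W k ω) x₀ n with hX
  have hX01 : ∀ n ω i, X n ω i ∈ Set.Icc (0 : ℝ) 1 := fun n ω i => hW.orbit_mem_Icc hx₀ n ω i
  have hXmeas : ∀ n i, Measurable[hW.filtration n] fun ω => X n ω i := hW.measurable_orbit x₀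
  have hsqmeas : ∀ n i, Measurable[hW.filtration n] fun ω => X n ω i ^ 2 := fun n i =>
    (hXmeas n i).pow_const 2
  have hdmeas : ∀ n i j, Measurable[hW.filtration n] fun ω => (X n ω i - X n ω j) ^ 2 :=
    fun n i j => ((hXmeas n i).sub (hXmeas n j)).pow_const 2
  have hsqint : ∀ n i, Integrable (fun ω => X n ω i ^ 2) P := fun n i =>
    .of_bound ((hsqmeas n i).mono (hW.filtration.le n) le_rfl).aestronglyMeasurable 1
      (ae_of_all _ fun ω => by
        rw [Real.norm_of_nonneg (sq_nonneg _)]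
        exact pow_le_one₀ (hX01 n ω i).1 (hX01 n ω i).2)
  have hdint : ∀ n i j, Integrable (fun ω => (X n ω i - X n ω j) ^ 2) P := fun n i j =>
    .of_bound ((hdmeas n i j).mono (hW.filtration.le n) le_rfl).aestronglyMeasurable 1
      (ae_of_all _ fun ω => by
        rw [Real.norm_of_nonneg (sq_nonneg _), sq_le_one_iff_abs_le_one, abs_le]
        constructor <;> linarith [(hX01 n ω i).1, (hX01 n ω i).2, (hX01 n ω j).1, (hX01 n ω j).2])
  set D : ℕ → Fin m → Fin m → Ω → ℝ := fun n i j ω =>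
    (W (n + 1) ω i j + W (n + 1) ω j i) * (X n ω i - X n ω j) ^ 2 with hD
  have hD0 : ∀ n i j ω, 0 ≤ D n i j ω := fun n i j ω =>
    mul_nonneg (add_nonneg (hW.nonneg _ _ _ _) (hW.nonneg _ _ _ _)) (sq_nonneg _)
  have hDint : ∀ n i j, Integrable (D n i j) P := fun n i j => by
    simp only [hD, add_mul]
    exact (integrable_entry_mul hW _ _ _ (hdint n i j)).add
      (integrable_entry_mul hW _ _ _ (hdint n i j))
  set E : ℕ → Fin m → Fin m → Ω → ℝ := fun n i j ω =>
    ((W (n + 1) ω).col i ⬝ᵥ (W (n + 1) ω).col j) * (X n ω i - X n ω j) ^ 2 with hE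
  have hEint : ∀ n i j, Integrable (E n i j) P := fun n i j => by
    simp only [hE, dotProduct, Finset.sum_mul, mul_assoc]
    exact integrable_finsetSum _ fun l _ =>
      integrable_entry_mul hW _ _ _ (integrable_entry_mul hW _ _ _ (hdint n i j))
  have hDE : ∀ n i j, γ * ∫ ω, D n i j ω ∂P ≤ ∫ ω, E n i j ω ∂P := by
    intro n i j
    -- Weak feedback says nothing on the diagonal, but there both sides vanish.
    by_cases hij : i = j
    · subst hij; simp [hD, hE]
    have h1 : ∫ ω, E n i j ω ∂P = (∫ ω, (W (n + 1) ω).col i ⬝ᵥ (W (n + 1) ω).col j ∂P) *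
        ∫ ω, (X n ω i - X n ω j) ^ 2 ∂P :=
      integral_mul_of_measurable_filtration hW hindep
        (g := fun M => (fun l => M l i) ⬝ᵥ fun l => M l j)
        (by simp only [dotProduct]; fun_prop) (hdmeas n i j)
    have h2 : ∫ ω, D n i j ω ∂P = (expectedMatrix P W (n + 1) i j +
        expectedMatrix P W (n + 1) j i) * ∫ ω, (X n ω i - X n ω j) ^ 2 ∂P := by
      simp only [hD, add_mul]
      rw [integral_add (integrable_entry_mul hW _ _ _ (hdint n i j))
        (integrable_entry_mul hW _ _ _ (hdint n i j)),
        integral_entry_mul hW hindep _ _ (hdmeas n i j),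
        integral_entry_mul hW hindep _ _ (hdmeas n i j)]
    rw [h1, h2, ← mul_assoc]
    exact mul_le_mul_of_nonneg_right (hfb (n + 1) i j hij)
      (integral_nonneg fun ω => sq_nonneg _)
  set Q : ℕ → Ω → ℝ := fun n ω => ∑ i, v i * X n ω i ^ 2 with hQ
  have hQint : ∀ n, Integrable (Q n) P := fun n =>
    integrable_finsetSum _ fun i _ => (hsqint n i).const_mul _
  set T : ℕ → Ω → ℝ := fun n ω => ∑ i, ∑ j, D n i j ω with hT
  have hTint : ∀ n, Integrable (T n) P := fun n =>
    integrable_finsetSum _ fun i _ => integrable_finsetSum _ fun j _ => hDint n i j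
  have hT0 : ∀ n ω, 0 ≤ T n ω := fun n ω =>
    Finset.sum_nonneg fun i _ => Finset.sum_nonneg fun j _ => hD0 n i j ω
  have hpath : ∀ n ω, Q (n + 1) ω ≤ (∑ l, v l * ∑ i, W (n + 1) ω l i * X n ω i ^ 2) -
      δ / 2 * ∑ i, ∑ j, E n i j ω := by
    intro n ω
    -- Expanding the column products turns the total into a sum of row variances, one for each `l`.
    have hEsum : ∑ i, ∑ j, E n i j ω = ∑ l, ∑ i, ∑ j,
        W (n + 1) ω l i * W (n + 1) ω l j * (X n ω i - X n ω j) ^ 2 := by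
      rw [Finset.sum_comm]
      simp only [hE, dotProduct, Finset.sum_mul]
      rw [Finset.sum_comm]
      conv_rhs => rw [Finset.sum_comm]
      refine Finset.sum_congr rfl fun i _ => ?_
      rw [Finset.sum_comm]
      rfl
    rw [hEsum, Finset.mul_sum, ← Finset.sum_sub_distrib]
    refine Finset.sum_le_sum fun l _ => ?_
    have hstep : X (n + 1) ω l = ∑ i, W (n + 1) ω l i * X n ω i := rfl
    rw [hstep, sq_sum_weighted (hW.sum_row (n + 1) ω l), mul_sub]
    have hnn : 0 ≤ ∑ i, ∑ j,
        W (n + 1) ω l i * W (n + 1) ω l j * (X n ω i - X n ω j) ^ 2 :=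
      Finset.sum_nonneg fun i _ => Finset.sum_nonneg fun j _ =>
        mul_nonneg (mul_nonneg (hW.nonneg _ _ _ _) (hW.nonneg _ _ _ _)) (sq_nonneg _)
    nlinarith [mul_le_mul_of_nonneg_right (hδv l) hnn]
  have hdecr : ∀ n, ∫ ω, Q (n + 1) ω ∂P ≤ ∫ ω, Q n ω ∂P - δ / 2 * γ * ∫ ω, T n ω ∂P := by
    intro n
    have hEi : Integrable (fun ω => ∑ i, ∑ j, E n i j ω) P :=
      integrable_finsetSum _ fun i _ => integrable_finsetSum _ fun j _ => hEint n i j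
    have hSi : Integrable (fun ω => ∑ l, v l * ∑ i, W (n + 1) ω l i * X n ω i ^ 2) P :=
      integrable_finsetSum _ fun l _ => (integrable_finsetSum _ fun i _ =>
        integrable_entry_mul hW _ _ _ (hsqint n i)).const_mul _
    have h1 := integral_mono (hQint (n + 1)) (hSi.sub (hEi.const_mul (δ / 2))) (hpath n)
    have h2 := integral_sum_steady hW hindep hsteady (n := n) (f := fun i ω => X n ω i ^ 2)
      (hsqmeas n) (hsqint n)
    have h3 : γ * ∫ ω, T n ω ∂P ≤ ∫ ω, ∑ i, ∑ j, E n i j ω ∂P := by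
      rw [integral_finsetSum _ fun i _ => integrable_finsetSum _ fun j _ => hDint n i j,
        integral_finsetSum _ fun i _ => integrable_finsetSum _ fun j _ => hEint n i j,
        Finset.mul_sum]
      refine Finset.sum_le_sum fun i _ => ?_
      rw [integral_finsetSum _ fun j _ => hDint n i j, integral_finsetSum _ fun j _ => hEint n i j,
        Finset.mul_sum]
      exact Finset.sum_le_sum fun j _ => hDE n i j
    have h4 : ∫ ω, Q (n + 1) ω ∂P ≤ ∫ ω, Q n ω ∂P - δ / 2 * ∫ ω, ∑ i, ∑ j, E n i j ω ∂P := by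
      refine h1.trans (le_of_eq ?_)
      simp only [Pi.sub_apply]
      rw [integral_sub hSi (hEi.const_mul (δ / 2)), h2, integral_const_mul]
    nlinarith [mul_le_mul_of_nonneg_left h3 (half_pos hδ).le]
  have hpos : 0 < δ / 2 * γ := mul_pos (half_pos hδ) hγ
  have hpartial : ∀ N, δ / 2 * γ * ∑ n ∈ Finset.range N, ∫ ω, T n ω ∂P ≤
      ∫ ω, Q 0 ω ∂P - ∫ ω, Q N ω ∂P := by
    intro N
    induction N with
    | zero => simp
    | succ N ih => rw [Finset.sum_range_succ, mul_add]; linarith [hdecr N]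
  have hbound : ∀ N, ∑ n ∈ Finset.range N, ∫ ω, T n ω ∂P ≤ (∫ ω, Q 0 ω ∂P) / (δ / 2 * γ) := by
    intro N
    rw [le_div_iff₀ hpos, mul_comm]
    have : 0 ≤ ∫ ω, Q N ω ∂P := integral_nonneg fun ω =>
      Finset.sum_nonneg fun i _ => mul_nonneg (hv i).le (sq_nonneg _)
    linarith [hpartial N]
  filter_upwards [ae_summable_of_sum_integral_le hTint hT0 hbound] with ω hω i j
  refine hω.of_nonneg_of_le (fun n => hD0 n i j ω) fun n => ?_
  refine le_trans ?_ (Finset.single_le_sum (f := fun i => ∑ j, D n i j ω)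
    (fun i _ => Finset.sum_nonneg fun j _ => hD0 n i j ω) (Finset.mem_univ i))
  exact Finset.single_le_sum (f := fun j => D n i j ω) (fun j _ => hD0 n i j ω) (Finset.mem_univ j)

end RandomChain

namespace RandomChain

variable {m : ℕ} {Ω : Type*} [MeasurableSpace Ω]

variable {P : Measure Ω} {W : ℕ → Ω → Matrix (Fin m) (Fin m) ℝ}

/-! ### Almost sure convergence of random orbits -/

/-- By Jensen, the squared increment of coordinate `i` is at most `∑ j, W_ij (x_j - x_i)²`, which
tends to zero as a term of a convergent series; the convergence criterion then applies. -/
theorem ae_exists_tendsto_orbit [IsProbabilityMeasure P] (hW : IsRandomModel W)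
    (hindep : IsIndependent P W) {v : Fin m → ℝ} (hv : ∀ i, 0 < v i)
    (hsteady : HasCommonSteadyState P W v) (hfeedback : HasWeakFeedback P W) {x₀ : Fin m → ℝ}
    (hx₀ : ∀ i, x₀ i ∈ Set.Icc (0 : ℝ) 1) :
    ∀ᵐ ω ∂P, ∀ i, ∃ l, Tendsto (fun n => orbit (fun k => W k ω) x₀ n i) atTop (𝓝 l) := by
  have hconv : ∀ᵐ ω ∂P, ∀ c : ℚ, ∃ l, Tendsto
      (fun n => ∑ i, v i * |orbit (fun k => W k ω) x₀ n i - c|) atTop (𝓝 l) :=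
    ae_all_iff.2 fun c => ae_exists_tendsto_sum_abs hW hindep hv hsteady hx₀ c
  filter_upwards [hconv, ae_summable_flow_mul_sq hW hindep hv hsteady hfeedback hx₀]
    with ω hω hsum i
  refine exists_tendsto_of_step_of_sum_abs hv (fun n j => hW.orbit_mem_Icc hx₀ n ω j) ?_ hω
  set x : ℕ → Fin m → ℝ := orbit (fun k => W k ω) x₀ with hx
  have hzero := (summable_sum fun j (_ : j ∈ Finset.univ) => hsum i j).tendsto_atTop_zero
  have hsq : Tendsto (fun n => (x (n + 1) i - x n i) ^ 2) atTop (𝓝 0) := by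
    refine squeeze_zero (fun n => sq_nonneg _) (fun n => ?_) hzero
    have hstep : x (n + 1) i - x n i = ∑ j, W (n + 1) ω i j * (x n j - x n i) := by
      simp only [mul_sub, Finset.sum_sub_distrib, ← Finset.sum_mul, hW.sum_row, one_mul]
      rfl
    have hnn : 0 ≤ ∑ p, ∑ q, W (n + 1) ω i p * W (n + 1) ω i q *
        (x n p - x n i - (x n q - x n i)) ^ 2 :=
      Finset.sum_nonneg fun p _ => Finset.sum_nonneg fun q _ =>
        mul_nonneg (mul_nonneg (hW.nonneg _ _ _ _) (hW.nonneg _ _ _ _)) (sq_nonneg _)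
    rw [hstep, sq_sum_weighted (hW.sum_row (n + 1) ω i)]
    refine (sub_le_self _ (mul_nonneg (by norm_num) hnn)).trans (Finset.sum_le_sum fun j _ => ?_)
    rw [← neg_sub (x n i) (x n j), neg_sq]
    exact mul_le_mul_of_nonneg_right (le_add_of_nonneg_right (hW.nonneg _ _ _ _)) (sq_nonneg _)
  have := hsq.sqrt
  simp only [Real.sqrt_sq_eq_abs, Real.sqrt_zero] at this
  exact (tendsto_zero_iff_abs_tendsto_zero _).2 this

/-- If `∑ a n = ∞` while `∑ a n * d n ^ 2 < ∞`, a convergent sequence `d` tends to zero. -/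
theorem tendsto_zero_of_summable_mul_sq {a d : ℕ → ℝ} (ha : ∀ n, 0 ≤ a n) (hna : ¬ Summable a)
    (hsum : Summable fun n => a n * d n ^ 2) {l : ℝ} (hd : Tendsto d atTop (𝓝 l)) :
    Tendsto d atTop (𝓝 0) := by
  by_cases hl : l = 0
  · rwa [hl] at hd
  refine absurd ?_ hna
  have hl2 : 0 < l ^ 2 / 2 := half_pos (by positivity)
  have hev : ∀ᶠ n in atTop, l ^ 2 / 2 < d n ^ 2 :=
    (hd.pow 2).eventually (lt_mem_nhds (by linarith))
  refine (hsum.mul_right (l ^ 2 / 2)⁻¹).of_norm_bounded_eventually_nat (hev.mono fun n hn => ?_)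
  rw [Real.norm_of_nonneg (ha n), ← div_eq_mul_inv, le_div_iff₀ hl2]
  exact mul_le_mul_of_nonneg_left hn.le (ha n)

/-! ### Shifting time -/

theorem IsRandomModel.shift (hW : IsRandomModel W) (t : ℕ) :
    IsRandomModel fun k => W (t + k) :=
  ⟨fun k => hW.measurable_entry (t + k), fun k => hW.stochastic (t + k)⟩

theorem IsIndependent.shift (h : IsIndependent P W) (t : ℕ) :
    IsIndependent P fun k => W (t + k) :=
  iIndepFun.precomp (g := fun k => t + k) (add_right_injective t) h

theorem HasWeakFeedback.shift (h : HasWeakFeedback P W) (t : ℕ) :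
    HasWeakFeedback P fun k => W (t + k) := by
  obtain ⟨γ, hγ, hfb⟩ := h
  exact ⟨γ, hγ, fun k => hfb (t + k)⟩

theorem single_mem_Icc (l i : Fin m) : (Pi.single l 1 : Fin m → ℝ) i ∈ Set.Icc (0 : ℝ) 1 := by
  by_cases h : i = l
  · subst h; simp
  · simp [h]

/-- All hypotheses survive a time shift, so each initial time reduces to time zero, and only
countably many null sets are discarded. -/
theorem ae_isStable [IsProbabilityMeasure P] (hW : IsRandomModel W)
    (hindep : IsIndependent P W) {v : Fin m → ℝ} (hv : ∀ i, 0 < v i)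
    (hsteady : HasCommonSteadyState P W v) (hfeedback : HasWeakFeedback P W) :
    ∀ᵐ ω ∂P, IsStable fun k => W k ω := by
  have h : ∀ᵐ ω ∂P, ∀ (t : ℕ) (l i : Fin m), ∃ a, Tendsto
      (fun n => orbit (fun k => W (t + k) ω) (Pi.single l 1) n i) atTop (𝓝 a) :=
    ae_all_iff.2 fun t => ae_all_iff.2 fun l =>
      ae_exists_tendsto_orbit (hW.shift t) (hindep.shift t) hv (fun k => hsteady (t + k))
        (hfeedback.shift t) (single_mem_Icc l)
  filter_upwards [h] with ω hω i
  exact ErgodicIndex.of_orbit fun t l => hω t l i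

theorem not_summable_of_tendsto_atTop {f : ℕ → ℝ}
    (hf : Tendsto (fun n => ∑ k ∈ Finset.range n, f k) atTop atTop) : ¬ Summable f := fun h =>
  not_tendsto_nhds_of_tendsto_atTop hf _ h.hasSum.tendsto_sum_nat

theorem ae_mutuallyWeaklyErgodic_of_adj [IsProbabilityMeasure P] (hW : IsRandomModel W)
    (hindep : IsIndependent P W) {v : Fin m → ℝ} (hv : ∀ i, 0 < v i)
    (hsteady : HasCommonSteadyState P W v) (hfeedback : HasWeakFeedback P W) {i j : Fin m}
    (hij : (infiniteFlowGraph P W).Adj i j) :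
    ∀ᵐ ω ∂P, MutuallyWeaklyErgodic (fun k => W k ω) i j := by
  have h : ∀ᵐ ω ∂P, ∀ (t : ℕ) (l : Fin m), Tendsto
      (fun n => orbit (fun k => W (t + k) ω) (Pi.single l 1) n i -
        orbit (fun k => W (t + k) ω) (Pi.single l 1) n j) atTop (𝓝 0) := by
    refine ae_all_iff.2 fun t => ae_all_iff.2 fun l => ?_
    filter_upwards [hij.2, ae_exists_tendsto_orbit (hW.shift t) (hindep.shift t) hv
      (fun k => hsteady (t + k)) (hfeedback.shift t) (single_mem_Icc l),
      ae_summable_flow_mul_sq (hW.shift t) (hindep.shift t) hv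
      (fun k => hsteady (t + k)) (hfeedback.shift t) (single_mem_Icc l)] with ω hω hlim hsum
    obtain ⟨a, ha⟩ := hlim i
    obtain ⟨b, hb⟩ := hlim j
    refine tendsto_zero_of_summable_mul_sq
      (fun n => add_nonneg (hW.nonneg _ _ _ _) (hW.nonneg _ _ _ _)) ?_ (hsum i j) (ha.sub hb)
    have hns := not_summable_of_tendsto_atTop hω
    -- The extra `1` is there because `orbit` at `n` is paired with the matrix at `n + 1` of the
    -- shifted chain.
    rw [← summable_nat_add_iff (t + 1)] at hns
    simpa only [show ∀ n, n + (t + 1) = t + (n + 1) by omega] using hns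
  filter_upwards [h] with ω hω
  exact MutuallyWeaklyErgodic.of_orbit hω

/-! ### Finite flow between non-adjacent indices -/

/-- By the zero-one law, the flow between two non-adjacent indices is almost surely finite. -/
theorem ae_summable_of_not_adj [IsProbabilityMeasure P] (hW : IsRandomModel W)
    (hindep : IsIndependent P W) {i j : Fin m} (hne : i ≠ j)
    (hij : ¬ (infiniteFlowGraph P W).Adj i j) :
    ∀ᵐ ω ∂P, Summable fun k => W k ω i j + W k ω j i := by
  set f : ℕ → Ω → ℝ := fun k ω => W k ω i j + W k ω j i with hf
  have hf0 : ∀ k ω, 0 ≤ f k ω := fun k ω => add_nonneg (hW.nonneg _ _ _ _) (hW.nonneg _ _ _ _)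
  set s : ℕ → MeasurableSpace Ω := fun k =>
    MeasurableSpace.comap (fun ω => (fun i j => W k ω i j : Fin m → Fin m → ℝ)) inferInstance
    with hs
  have hfs : ∀ k, Measurable[s k] (f k) := fun k => by
    have hg : Measurable fun M : Fin m → Fin m → ℝ => M i j + M j i := by fun_prop
    exact hg.comp (comap_measurable _)
  set T : Set Ω := {ω | Tendsto (fun n => ∑ k ∈ Finset.range n, f k ω) atTop atTop} with hT
  -- Divergence does not depend on finitely many terms, which makes `T` a tail event.
  have hTshift : ∀ N, T = {ω | Tendsto (fun n => ∑ k ∈ Finset.range n, f (k + N) ω)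
      atTop atTop} := by
    intro N
    ext ω
    simp only [hT, Set.mem_ofPred_eq]
    rw [← not_summable_iff_tendsto_nat_atTop_of_nonneg (fun k => hf0 k ω),
      ← not_summable_iff_tendsto_nat_atTop_of_nonneg (fun k => hf0 (k + N) ω),
      summable_nat_add_iff (f := fun k => f k ω) N]
  have htail : MeasurableSet[limsup s atTop] T := by
    rw [limsup_eq_iInf_iSup_of_nat, MeasurableSpace.measurableSet_iInf]
    intro N
    rw [hTshift N]
    have hmeas : ∀ n, Measurable[⨆ k ≥ N, s k] fun ω => ∑ k ∈ Finset.range n, f (k + N) ω :=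
      fun n => Finset.measurable_fun_sum _ fun k _ =>
        (hfs (k + N)).mono (le_iSup₂_of_le (k + N) (Nat.le_add_left N k) le_rfl) le_rfl
    exact @measurableSet_tendsto _ _ _ (⨆ k ≥ N, s k) _ _ _ _ _ _ _ _ hmeas
  have h01 := measure_zero_or_one_of_measurableSet_limsup_atTop
    (fun k => (hW.measurable_entries k).comap_le) hindep htail
  have hTmeas : MeasurableSet T := by
    refine measurableSet_tendsto _ fun n => Finset.measurable_fun_sum _ fun k _ => ?_
    exact (hW.measurable_entry k i j).add (hW.measurable_entry k j i)
  rcases h01 with h | h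
  · filter_upwards [measure_eq_zero_iff_ae_notMem.1 h] with ω hω
    by_contra hns
    exact hω ((not_summable_iff_tendsto_nat_atTop_of_nonneg fun k => hf0 k ω).1 hns)
  · exact absurd ⟨hne, (mem_ae_iff_prob_eq_one hTmeas).2 h⟩ hij

/-- Indices in distinct components of the infinite flow graph are almost surely not mutually
weakly ergodic. -/
theorem ae_not_mutuallyWeaklyErgodic [IsProbabilityMeasure P] (hW : IsRandomModel W)
    (hindep : IsIndependent P W) {i j : Fin m} (hij : ¬ (infiniteFlowGraph P W).Reachable i j) :
    ∀ᵐ ω ∂P, ¬ MutuallyWeaklyErgodic (fun k => W k ω) i j := by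
  set G := infiniteFlowGraph P W with hG
  have h : ∀ᵐ ω ∂P, ∀ p q, ¬ G.Reachable p q → Summable fun k => W k ω p q + W k ω q p := by
    refine ae_all_iff.2 fun p => ae_all_iff.2 fun q => ?_
    by_cases hpq : G.Reachable p q
    · exact ae_of_all _ fun ω hn => absurd hpq hn
    · have hne : p ≠ q := fun h => hpq (h ▸ SimpleGraph.Reachable.refl p)
      filter_upwards [ae_summable_of_not_adj hW hindep hne fun ha => hpq ha.reachable]
        with ω hω _ using hω
  filter_upwards [h] with ω hω
  -- The cut is the component of `i`: no edge of `G` leaves it, so every crossing flow is finite.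
  exact not_mutuallyWeaklyErgodic_of_summable (S := {p | G.Reachable i p})
    (fun k => hW.stochastic k ω)
    (fun p hp q hq => hω p q fun hpq => hq (SimpleGraph.Reachable.trans hp hpq))
    (SimpleGraph.Reachable.refl i) hij

theorem ae_mutuallyWeaklyErgodic_of_reachable [IsProbabilityMeasure P] (hW : IsRandomModel W)
    (hindep : IsIndependent P W) {v : Fin m → ℝ} (hv : ∀ i, 0 < v i)
    (hsteady : HasCommonSteadyState P W v) (hfeedback : HasWeakFeedback P W) {i j : Fin m}
    (hij : (infiniteFlowGraph P W).Reachable i j) :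
    ∀ᵐ ω ∂P, MutuallyWeaklyErgodic (fun k => W k ω) i j := by
  obtain ⟨p⟩ := hij
  induction p with
  | nil => exact ae_of_all _ fun ω t x _ => by simp
  | cons hadj _ ih =>
    filter_upwards [ae_mutuallyWeaklyErgodic_of_adj hW hindep hv hsteady hfeedback hadj, ih]
      with ω h1 h2 using h1.trans h2

end RandomChain

theorem mainTheorem2 {m : ℕ} {Ω : Type*} [MeasurableSpace Ω]
    (P : MeasureTheory.Measure Ω) [MeasureTheory.IsProbabilityMeasure P]
    (W : ℕ → Ω → Matrix (Fin m) (Fin m) ℝ)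
    (hW : RandomChain.IsRandomModel W)
    (hindep : RandomChain.IsIndependent P W)
    (v : Fin m → ℝ) (hvpos : ∀ i, 0 < v i)
    (hsteady : RandomChain.HasCommonSteadyState P W v)
    (hfeedback : RandomChain.HasWeakFeedback P W) :
    (∀ i j : Fin m,
      (∀ᵐ ω ∂P, RandomChain.MutuallyErgodic (fun k => W k ω) i j) ↔
        (RandomChain.infiniteFlowGraph P W).connectedComponentMk i =
          (RandomChain.infiniteFlowGraph P W).connectedComponentMk j) ∧
    (∀ᵐ ω ∂P, RandomChain.IsStable (fun k => W k ω)) := by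
  have hstable := RandomChain.ae_isStable hW hindep hvpos hsteady hfeedback
  refine ⟨fun i j => ?_, hstable⟩
  rw [SimpleGraph.ConnectedComponent.eq]
  constructor
  · intro h
    by_contra hij
    -- Two contradictory almost sure events would share a sample point, since `P` is a nonzero
    -- measure.
    obtain ⟨ω, h1, h2⟩ := (h.and (RandomChain.ae_not_mutuallyWeaklyErgodic hW hindep hij)).exists
    exact h2 h1.2.2
  · intro hij
    filter_upwards [hstable, RandomChain.ae_mutuallyWeaklyErgodic_of_reachable hW hindep hvpos
      hsteady hfeedback hij] with ω h1 h2
    exact ⟨h1 i, h1 j, h2⟩
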